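/- Let $K$ be a field, let $1\le t\le n$ be integers, and let $S=K[x_1,\dots,x_n]$. For an ideal $J$ of $S$ let $\mathrm{ass}(J)$ denote the set of associated prime ideals of the $S$-module $S/J$, and call $J$ normally torsion-free if $\mathrm{ass}(J^s)=\mathrm{ass}(J)$ for all integers $s\ge 1$. Let $L_n$ be the line (path) graph with vertices $1,\dots,n$ and edges $\{j,j+1\}$ for $1\le j\le n-1$. The $t$-path ideal $I_t(L_n)$ is the ideal of $S$ generated by the monomials $x_{i_1}\cdots x_{i_t}$ for all paths $i_1,\dots,i_t$ of $L_n$ on $t$ pairwise distinct vertices (for $t=1$, single vertices); that is, $I_t(L_n)=(x_ix_{i+1}\cdots x_{i+t-1} : 1\le i\le n-t+1)$. For a squarefree monomial ideal $I$ of $S$, its Alexander dual $I^\vee$ is the ideal generated by the monomials $\prod_{i\in C}x_i$, where $C$ ranges over all subsets of $\{1,\dots,n\}$ that meet the support of every minimal monomial generator of $I$ (the vertex covers). Then both $I_t(L_n)$ and its Alexander dual $I_t(L_n)^\vee$ are normally torsion-free, i.e. for all $s\ge 1$, $$\mathrm{ass}(I_t(L_n)^s)=\mathrm{ass}(I_t(L_n))\quad\text{and}\quad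 \mathrm{ass}((I_t(L_n)^\vee)^s)=\mathrm{ass}(I_t(L_n)^\vee).$$ -/

import Mathlib

noncomputable section

namespace PathIdeals

/-- An ideal `I` is normally torsion-free if `ass (I ^ s) = ass I` for all `s ≥ 1`, where
`ass J` is the set of associated primes of the module `R ⧸ J`. -/
def NormallyTorsionFree {R : Type*} [CommRing R] (I : Ideal R) : Prop :=
  ∀ s : ℕ, 1 ≤ s → associatedPrimes R (R ⧸ I ^ s) = associatedPrimes R (R ⧸ I)

/-- The squarefree monomial `x_F`, the product of the variables indexed by `F`. -/
def sqfreeMonomial (K : Type*) [Field K] {V : Type*} (F : Finset V) : MvPolynomial V K :=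
  ∏ i ∈ F, MvPolynomial.X i

/-- The vertex sets of the `t`-paths of `G`: paths through `t` pairwise distinct vertices,
hence with `t - 1` edges. For `t = 1` these are the single vertices. -/
def tPaths {V : Type*} [DecidableEq V] (G : SimpleGraph V) (t : ℕ) : Set (Finset V) :=
  {F | ∃ (u v : V) (p : G.Walk u v), p.IsPath ∧ p.length + 1 = t ∧ F = p.support.toFinset}

/-- The `t`-path ideal `I_t(G)`. -/
def pathIdeal (K : Type*) [Field K] {V : Type*} [DecidableEq V] (G : SimpleGraph V) (t : ℕ) :
    Ideal (MvPolynomial V K) :=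
  Ideal.span (sqfreeMonomial K '' tPaths G t)

/-- For a squarefree monomial ideal `I`, the facets of the simplicial complex `Δ` whose facet
ideal is `I`: the sets `F` such that `x_F` is a minimal monomial generator of `I`. -/
def facets {K : Type*} [Field K] {V : Type*} (I : Ideal (MvPolynomial V K)) : Set (Finset V) :=
  {F | Minimal (fun F' : Finset V => sqfreeMonomial K F' ∈ I) F}

/-- `C` is a vertex cover of the simplicial complex with the given facets: it meets every facet. -/
def IsVertexCover {V : Type*} (facetSet : Set (Finset V)) (C : Finset V) : Prop :=
  ∀ F ∈ facetSet, ∃ i ∈ C, i ∈ F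

/-- The Alexander dual of a squarefree monomial ideal `I = I(Δ)`: the ideal generated by all
`x_C` with `C` a vertex cover of `Δ`. -/
def alexanderDual {K : Type*} [Field K] {V : Type*} (I : Ideal (MvPolynomial V K)) :
    Ideal (MvPolynomial V K) :=
  Ideal.span (sqfreeMonomial K '' {C | IsVertexCover (facets I) C})

end PathIdeals

end

open MvPolynomial

/-! Let `𝒢` index the generators of a squarefree ideal, and let each set in `𝒞` meet each set in
`𝒢`. If every weight that is at least `s` on all of `𝒞` dominates a sum of `s` members of `𝒢`, then
the `s`-th power is the intersection of the `s`-th powers of the monomial primes of `𝒞`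
(`span_pow_eq_iInf`). For the minimal members of `𝒞` this is a minimal primary decomposition whose
radicals do not depend on `s`, so the associated primes do not either (`normallyTorsionFree_span`).

What remains is combinatorial: windows pack against covers (`exists_windows_packing`), which settles
the path ideal, and covers pack against windows (`exists_covers_packing`), which settles its dual.
-/

theorem Ideal.associatedPrimes_quotient_finsetInf {R ι : Type*} [CommRing R] (T : Finset ι)
    (q : ι → Ideal R) (hq : ∀ i ∈ T, (q i).IsPrimary)
    (hT : ∀ i ∈ T, ∀ j ∈ T, (q i).radical ≤ (q j).radical → i = j) :
    associatedPrimes R (R ⧸ T.inf q) = (fun i => (q i).radical) '' T := by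
  classical
  have hdec : Submodule.IsMinimalPrimaryDecomposition (T.inf q) (T.image q) := by
    refine ⟨by simp [Finset.inf_image], ?_, ?_, ?_⟩
    · intro J hJ
      obtain ⟨i, hi, rfl⟩ := Finset.mem_image.1 hJ
      exact hq i hi
    · intro J hJ J' hJ' hne
      obtain ⟨i, hi, rfl⟩ := Finset.mem_image.1 (Finset.mem_coe.1 hJ)
      obtain ⟨j, hj, rfl⟩ := Finset.mem_image.1 (Finset.mem_coe.1 hJ')
      simp only [Function.onFun, Submodule.colon_univ]
      intro h
      exact hne (congrArg q (hT i hi j hj h.le))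
    -- Irredundance: a prime containing a finite intersection contains one of its members, so a
    -- redundant component would make two radicals comparable.
    · intro J hJ hle
      obtain ⟨i, hi, rfl⟩ := Finset.mem_image.1 hJ
      have hprime : (q i).radical.IsPrime := Ideal.isPrime_radical (hq i hi)
      have h1 := hle.trans Ideal.le_radical
      obtain ⟨J', hJ', h2⟩ := (Ideal.IsPrime.inf_le' hprime).1 h1
      obtain ⟨hne, hJ'⟩ := Finset.mem_erase.1 hJ'
      obtain ⟨j, hj, rfl⟩ := Finset.mem_image.1 hJ'
      have h3 : (q j).radical ≤ (q i).radical := (hprime.radical_le_iff).2 h2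
      exact hne (congrArg q (hT j hj i hi h3))
  have himg := hdec.image_radical_eq_associated_primes
  have hass : associatedPrimes R (R ⧸ T.inf q) = Submodule.associatedPrimes (T.inf q) := by
    have hcolon : ∀ x : R, Submodule.colon (⊥ : Submodule R (R ⧸ T.inf q))
        {Ideal.Quotient.mk (T.inf q) x} = Submodule.colon (T.inf q) {x} := by
      intro x
      ext r
      rw [Submodule.mem_colon_singleton, Submodule.mem_colon_singleton, Submodule.mem_bot,
        smul_eq_mul, ← Ideal.Quotient.eq_zero_iff_mem, map_mul]
      rfl
    ext P
    constructor
    · rintro ⟨hP, y, hy⟩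
      obtain ⟨x, rfl⟩ := Ideal.Quotient.mk_surjective y
      exact ⟨hP, x, by rw [hy, hcolon]⟩
    · rintro ⟨hP, x, hx⟩
      exact ⟨hP, Ideal.Quotient.mk _ x, by rw [hx, hcolon]⟩
  rw [hass, ← himg]
  ext P
  simp [Submodule.colon_univ]

namespace PathIdeals

variable {K : Type*} [Field K] {σ : Type*}

/-! ### Weight ideals and their radicals -/

/-- The polynomials all of whose monomials have `w`-weight at least `s`. -/
def weightIdeal (K : Type*) [Field K] {σ : Type*} (w : σ → ℕ) (s : ℕ) :
    Ideal (MvPolynomial σ K) where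
  carrier := {f | (s : ℕ∞) ≤ (f : MvPowerSeries σ K).weightedOrder w}
  add_mem' {f g} hf hg := by
    simp only [Set.mem_ofPred_eq, coe_add] at *
    exact (le_min hf hg).trans (MvPowerSeries.min_weightedOrder_le_add w)
  zero_mem' := by simp
  smul_mem' c f hf := by
    simp only [Set.mem_ofPred_eq, smul_eq_mul, coe_mul, MvPowerSeries.weightedOrder_mul] at *
    exact hf.trans le_add_self

theorem mem_weightIdeal {w : σ → ℕ} {s : ℕ} {f : MvPolynomial σ K} :
    f ∈ weightIdeal K w s ↔ (s : ℕ∞) ≤ (f : MvPowerSeries σ K).weightedOrder w := Iff.rfl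

theorem mem_weightIdeal_iff {w : σ → ℕ} {s : ℕ} {f : MvPolynomial σ K} :
    f ∈ weightIdeal K w s ↔ ∀ a ∈ f.support, s ≤ Finsupp.weight w a := by
  rw [mem_weightIdeal]
  constructor
  · intro h a ha
    have h1 : MvPowerSeries.coeff a (f : MvPowerSeries σ K) ≠ 0 := by
      rwa [coeff_coe, ← mem_support_iff]
    exact_mod_cast h.trans (MvPowerSeries.weightedOrder_le w h1)
  · intro h
    refine MvPowerSeries.nat_le_weightedOrder w fun d hd => ?_
    rw [coeff_coe]
    by_contra hne
    exact absurd (h d (mem_support_iff.2 hne)) (not_le.2 hd)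

theorem mem_radical_weightIdeal {w : σ → ℕ} {s : ℕ} (hs : 1 ≤ s) {f : MvPolynomial σ K} :
    f ∈ (weightIdeal K w s).radical ↔ f ∈ weightIdeal K w 1 := by
  constructor
  · rintro ⟨m, hm⟩
    rw [mem_weightIdeal] at *
    by_contra h
    have h0 : (f : MvPowerSeries σ K).weightedOrder w = 0 := by
      simpa [Order.one_le_iff_ne_zero] using h
    have hp : ((f ^ m : MvPolynomial σ K) : MvPowerSeries σ K).weightedOrder w = 0 := by
      clear hm
      rw [coe_pow]
      induction m with
      | zero => simp
      | succ m ih => rw [pow_succ, MvPowerSeries.weightedOrder_mul, h0, ih, add_zero]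
    rw [hp] at hm
    have : s ≤ 0 := by exact_mod_cast hm
    omega
  · intro h
    refine ⟨s, ?_⟩
    rw [mem_weightIdeal] at *
    rw [coe_pow]
    refine le_trans ?_ (MvPowerSeries.le_weightedOrder_pow w s)
    calc (s : ℕ∞) = s • (1 : ℕ∞) := by simp
      _ ≤ _ := nsmul_le_nsmul_right (by exact_mod_cast h) s

theorem radical_weightIdeal (w : σ → ℕ) {s : ℕ} (hs : 1 ≤ s) :
    (weightIdeal K w s).radical = weightIdeal K w 1 :=
  Ideal.ext fun _ => mem_radical_weightIdeal hs

/-- Over a field the weighted order is additive on products, so a factor outside the radical, having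
order zero, does not change the order. -/
theorem isPrimary_weightIdeal (w : σ → ℕ) {s : ℕ} (hs : 1 ≤ s) :
    (weightIdeal K w s).IsPrimary := by
  rw [Ideal.isPrimary_iff]
  constructor
  · rw [Ne, Ideal.eq_top_iff_one, mem_weightIdeal]
    simp
    omega
  · intro f g hfg
    rw [radical_weightIdeal w hs]
    by_contra! h
    rw [mem_weightIdeal] at *
    rw [mem_weightIdeal] at h
    have h0 : (g : MvPowerSeries σ K).weightedOrder w = 0 := by
      simpa [Order.one_le_iff_ne_zero] using h.2
    rw [coe_mul, MvPowerSeries.weightedOrder_mul, h0, add_zero] at hfg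
    exact h.1 hfg

theorem pow_le_weightIdeal {w : σ → ℕ} {I : Ideal (MvPolynomial σ K)}
    (hI : I ≤ weightIdeal K w 1) (s : ℕ) : I ^ s ≤ weightIdeal K w s := by
  induction s with
  | zero => intro f _; simp [mem_weightIdeal]
  | succ s ih =>
    rw [pow_succ, Ideal.mul_le]
    intro f hf g hg
    have h1 := ih hf
    have h2 := hI hg
    rw [mem_weightIdeal] at *
    rw [coe_mul, MvPowerSeries.weightedOrder_mul]
    push_cast at *
    exact add_le_add h1 h2

theorem sqfreeMonomial_eq_monomial (F : Finset σ) :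
    sqfreeMonomial K F = monomial (∑ i ∈ F, Finsupp.single i 1) 1 := by
  rw [sqfreeMonomial, monomial_sum_one]
  rfl

variable [DecidableEq σ]

theorem sum_single_apply (F : Finset σ) (i : σ) :
    (∑ j ∈ F, Finsupp.single j 1 : σ →₀ ℕ) i = if i ∈ F then 1 else 0 := by
  simp [Finsupp.finsetSum_apply, Finsupp.single_apply]

/-- The indicator weight of a set of variables. -/
def indicatorWeight (C : Finset σ) (i : σ) : ℕ := if i ∈ C then 1 else 0

theorem weight_indicatorWeight (C : Finset σ) (a : σ →₀ ℕ) :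
    Finsupp.weight (indicatorWeight C) a = ∑ i ∈ C, a i := by
  rw [Finsupp.weight_apply, Finsupp.sum]
  simp only [indicatorWeight, smul_eq_mul, mul_ite, mul_one, mul_zero]
  rw [← Finset.sum_filter, Finset.filter_mem_eq_inter]
  refine Finset.sum_subset Finset.inter_subset_right fun i hi h => ?_
  by_contra hne
  exact h (Finset.mem_inter.2 ⟨Finsupp.mem_support_iff.2 hne, hi⟩)

theorem sqfreeMonomial_mem_weightIdeal {F C : Finset σ} :
    sqfreeMonomial K F ∈ weightIdeal K (indicatorWeight C) 1 ↔ ∃ i ∈ C, i ∈ F := by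
  classical
  rw [mem_weightIdeal_iff, sqfreeMonomial_eq_monomial, support_monomial, if_neg one_ne_zero]
  simp only [Finset.mem_singleton, forall_eq, weight_indicatorWeight, sum_single_apply,
    Nat.one_le_iff_ne_zero]
  simp [← Finset.not_disjoint_iff_nonempty_inter, Finset.not_disjoint_iff,
    ← Finset.nonempty_iff_ne_empty]

/-! ### From integral packing to normal torsion-freeness -/

/-- If every member of `𝒞` meets every member of `𝒢`, and the fractional packing inequalities
given by `𝒞` guarantee integral packings by members of `𝒢`, then the powers of the ideal
generated by `𝒢` are intersections of weight ideals. -/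
theorem span_pow_eq_iInf {𝒢 𝒞 : Set (Finset σ)}
    (hmeet : ∀ C ∈ 𝒞, ∀ F ∈ 𝒢, ∃ i ∈ C, i ∈ F)
    (hpack : ∀ (s : ℕ) (a : σ → ℕ), (∀ C ∈ 𝒞, s ≤ ∑ i ∈ C, a i) →
      ∃ F : Fin s → Finset σ, (∀ k, F k ∈ 𝒢) ∧ ∀ i, (∑ k, if i ∈ F k then 1 else 0) ≤ a i)
    (s : ℕ) :
    Ideal.span (sqfreeMonomial K '' 𝒢) ^ s =
      ⨅ C ∈ 𝒞, weightIdeal K (indicatorWeight C) s := by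
  apply le_antisymm
  · refine le_iInf₂ fun C hC => pow_le_weightIdeal ?_ s
    rw [Ideal.span_le]
    rintro _ ⟨F, hF, rfl⟩
    exact sqfreeMonomial_mem_weightIdeal.2 (hmeet C hC F hF)
  · intro f hf
    rw [Submodule.mem_iInf] at hf
    rw [f.as_sum]
    refine Ideal.sum_mem _ fun a ha => ?_
    -- The exponent vector of each monomial of `f` is itself the weight to pack; the packing is a
    -- product of `s` generators dividing that monomial.
    obtain ⟨F, hF, hFa⟩ := hpack s a fun C hC => by
      have h := hf C
      rw [Submodule.mem_iInf] at h
      rw [← weight_indicatorWeight]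
      exact mem_weightIdeal_iff.1 (h hC) a ha
    have hprod : ∏ k, sqfreeMonomial K (F k) ∈ Ideal.span (sqfreeMonomial K '' 𝒢) ^ s := by
      have h := Ideal.prod_mem_prod (s := Finset.univ)
        (I := fun _ : Fin s => Ideal.span (sqfreeMonomial K '' 𝒢))
        (x := fun k => sqfreeMonomial K (F k))
        fun k _ => Ideal.subset_span ⟨F k, hF k, rfl⟩
      simpa using h
    refine Ideal.mem_of_dvd _ ?_ hprod
    simp_rw [sqfreeMonomial_eq_monomial]
    rw [← monomial_sum_one, monomial_dvd_monomial]
    refine ⟨Or.inr fun i => ?_, one_dvd _⟩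
    rw [Finsupp.finsetSum_apply]
    simp_rw [sum_single_apply]
    exact hFa i

theorem normallyTorsionFree_span [Finite σ] {𝒢 𝒞 : Set (Finset σ)}
    (hmeet : ∀ C ∈ 𝒞, ∀ F ∈ 𝒢, ∃ i ∈ C, i ∈ F)
    (hpack : ∀ (s : ℕ) (a : σ → ℕ), (∀ C ∈ 𝒞, s ≤ ∑ i ∈ C, a i) →
      ∃ F : Fin s → Finset σ, (∀ k, F k ∈ 𝒢) ∧ ∀ i, (∑ k, if i ∈ F k then 1 else 0) ≤ a i) :
    NormallyTorsionFree (Ideal.span (sqfreeMonomial K '' 𝒢)) := by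
  have hfin : {C | Minimal (· ∈ 𝒞) C}.Finite := Set.toFinite _
  have hT : ∀ C, C ∈ hfin.toFinset ↔ Minimal (· ∈ 𝒞) C := fun C => by simp
  have key : ∀ s, 1 ≤ s → associatedPrimes (MvPolynomial σ K)
      (MvPolynomial σ K ⧸ Ideal.span (sqfreeMonomial K '' 𝒢) ^ s) =
      (fun C => weightIdeal K (indicatorWeight C) 1) '' (hfin.toFinset : Set (Finset σ)) := by
    intro s hs
    -- Keeping only minimal members preserves the packing hypothesis, since sums over subsets are
    -- smaller, and makes the primes pairwise incomparable.
    have hmin := span_pow_eq_iInf (K := K) (𝒢 := 𝒢) (𝒞 := {C | Minimal (· ∈ 𝒞) C})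
      (fun C hC => hmeet C hC.1) (fun s a h => hpack s a fun C hC => by
        obtain ⟨D, hDC, hD⟩ := exists_minimal_le_of_wellFoundedLT (· ∈ 𝒞) C hC
        exact (h D hD).trans (Finset.sum_le_sum_of_subset hDC)) s
    have hinf : Ideal.span (sqfreeMonomial K '' 𝒢) ^ s =
        hfin.toFinset.inf fun C => weightIdeal K (indicatorWeight C) s := by
      rw [hmin, Finset.inf_eq_iInf]
      simp [hT]
    rw [hinf, Ideal.associatedPrimes_quotient_finsetInf]
    · simp_rw [radical_weightIdeal _ hs]
    · exact fun C _ => isPrimary_weightIdeal _ hs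
    · intro C hC D hD hle
      rw [radical_weightIdeal _ hs, radical_weightIdeal _ hs] at hle
      have hsub : C ⊆ D := fun i hi => by
        have h := hle (sqfreeMonomial_mem_weightIdeal (F := {i}).2 ⟨i, hi, by simp⟩)
        obtain ⟨j, hj, hji⟩ := sqfreeMonomial_mem_weightIdeal.1 h
        rwa [Finset.mem_singleton.1 hji] at hj
      exact ((hT D).1 hD).eq_of_le ((hT C).1 hC).1 hsub
  intro s hs
  have h1 := key 1 le_rfl
  rw [pow_one] at h1
  rw [key s hs, h1]

/-! ### Paths of the line graph are windows -/

/-- The window of `t` consecutive vertices starting at `l`. -/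
def window (n t l : ℕ) : Finset (Fin n) :=
  Finset.univ.filter fun i => l ≤ i.1 ∧ i.1 < l + t

theorem mem_window {n t l : ℕ} {i : Fin n} : i ∈ window n t l ↔ l ≤ i.1 ∧ i.1 < l + t := by
  simp [window]

/-- The set of all windows of `t` consecutive vertices in a line of `n` vertices. -/
def windows (n t : ℕ) : Set (Finset (Fin n)) := {F | ∃ l, l + t ≤ n ∧ F = window n t l}

theorem card_window {n t l : ℕ} (h : l + t ≤ n) : (window n t l).card = t := by
  have h1 : (window n t l).map Fin.valEmbedding = Finset.Ico l (l + t) := by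
    ext x
    simp only [Finset.mem_map, mem_window, Fin.valEmbedding_apply, Finset.mem_Ico]
    constructor
    · rintro ⟨i, hi, rfl⟩
      exact hi
    · intro hx
      exact ⟨⟨x, by omega⟩, hx, rfl⟩
  rw [← Finset.card_map Fin.valEmbedding, h1]
  simp

/-- Each step of a walk moves by one, so prepending a vertex extends an interval by at most one
neighbouring point. -/
theorem exists_mem_support_iff_pathGraph {n : ℕ} {u v : Fin n}
    (p : (SimpleGraph.pathGraph n).Walk u v) :
    ∃ l m : ℕ, m < n ∧ ∀ w : Fin n, w ∈ p.support ↔ l ≤ w.1 ∧ w.1 ≤ m := by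
  induction p with
  | @nil u =>
    refine ⟨u.1, u.1, u.2, fun w => ?_⟩
    simp only [SimpleGraph.Walk.support_nil, List.mem_singleton, Fin.ext_iff]
    omega
  | @cons u v w h p ih =>
    obtain ⟨l, m, hm, ih⟩ := ih
    rw [SimpleGraph.pathGraph_adj] at h
    have hv := (ih v).1 p.start_mem_support
    refine ⟨min l u.1, max m u.1, by omega, fun x => ?_⟩
    rw [SimpleGraph.Walk.support_cons, List.mem_cons, ih, Fin.ext_iff]
    omega

theorem exists_isPath_pathGraph {n : ℕ} (l k : ℕ) (h : l + k < n) :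
    ∃ p : (SimpleGraph.pathGraph n).Walk ⟨l + k, h⟩ ⟨l, by omega⟩, p.IsPath ∧ p.length = k ∧
      ∀ w : Fin n, w ∈ p.support ↔ l ≤ w.1 ∧ w.1 ≤ l + k := by
  induction k with
  | zero =>
    refine ⟨SimpleGraph.Walk.nil, SimpleGraph.Walk.IsPath.nil, rfl, fun w => ?_⟩
    simp only [SimpleGraph.Walk.support_nil, List.mem_singleton, Fin.ext_iff]
    omega
  | succ k ih =>
    obtain ⟨p, hp, hlen, hsupp⟩ := ih (by omega)
    refine ⟨SimpleGraph.Walk.cons (SimpleGraph.pathGraph_adj.2 (Or.inr (by simp; omega))) p,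
      ?_, by simp [hlen], fun w => ?_⟩
    · rw [SimpleGraph.Walk.cons_isPath_iff]
      refine ⟨hp, fun hmem => ?_⟩
      have := (hsupp _).1 hmem
      simp at this
    · rw [SimpleGraph.Walk.support_cons, List.mem_cons, hsupp, Fin.ext_iff]
      simp only
      omega

theorem tPaths_pathGraph {n t : ℕ} (ht : 1 ≤ t) :
    tPaths (SimpleGraph.pathGraph n) t = windows n t := by
  ext F
  constructor
  · rintro ⟨u, v, p, hp, hlen, rfl⟩
    obtain ⟨l, m, hm, hsupp⟩ := exists_mem_support_iff_pathGraph p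
    have hu := (hsupp u).1 p.start_mem_support
    have hF : p.support.toFinset = window n (m + 1 - l) l := by
      ext w
      rw [List.mem_toFinset, hsupp, mem_window]
      omega
    -- A path does not repeat vertices, so counting forces the interval to have length `t`.
    have hcard : p.support.toFinset.card = t := by
      rw [List.toFinset_card_of_nodup hp.support_nodup, SimpleGraph.Walk.length_support, hlen]
    have hcard' := card_window (n := n) (t := m + 1 - l) (l := l) (by omega)
    rw [← hF, hcard] at hcard'
    exact ⟨l, by omega, by rw [hF, hcard']⟩
  · rintro ⟨l, hl, rfl⟩
    obtain ⟨p, hp, hlen, hsupp⟩ := exists_isPath_pathGraph (n := n) l (t - 1) (by omega)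
    refine ⟨_, _, p, hp, by omega, ?_⟩
    ext w
    rw [List.mem_toFinset, hsupp, mem_window]
    omega

/-! ### Facets and vertex covers -/

theorem sqfreeMonomial_mem_span {K : Type*} [Field K] {σ : Type*}
    {𝒢 : Set (Finset σ)} {F : Finset σ} :
    sqfreeMonomial K F ∈ Ideal.span (sqfreeMonomial K '' 𝒢) ↔ ∃ G ∈ 𝒢, G ⊆ F := by
  classical
  have himg : sqfreeMonomial K '' 𝒢 = (fun a => MvPolynomial.monomial a (1 : K)) ''
      ((fun G : Finset σ => ∑ i ∈ G, Finsupp.single i 1) '' 𝒢) := by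
    rw [Set.image_image]
    exact Set.image_congr fun G _ => sqfreeMonomial_eq_monomial G
  rw [himg, MvPolynomial.mem_ideal_span_monomial_image, sqfreeMonomial_eq_monomial,
    MvPolynomial.support_monomial, if_neg one_ne_zero]
  simp only [Finset.mem_singleton, forall_eq, Set.exists_mem_image, Finsupp.le_def,
    sum_single_apply]
  refine exists_congr fun G => and_congr_right fun _ => ⟨fun h i hi => ?_, fun h i => ?_⟩
  · by_contra hn
    have := h i
    simp [hi, hn] at this
  · by_cases hi : i ∈ G
    · simp [hi, h hi]
    · simp [hi]

/-- Every generator contains a facet and every facet contains a generator, so the dual can be read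
off any generating family. -/
theorem isVertexCover_facets_span {K : Type*} [Field K] {σ : Type*}
    {𝒢 : Set (Finset σ)} {C : Finset σ} :
    IsVertexCover (facets (Ideal.span (sqfreeMonomial K '' 𝒢))) C ↔ IsVertexCover 𝒢 C := by
  constructor
  · intro h F hF
    obtain ⟨D, hDF, hD⟩ := exists_minimal_le_of_wellFoundedLT
      (fun F' : Finset σ => sqfreeMonomial K F' ∈ Ideal.span (sqfreeMonomial K '' 𝒢)) F
      (Ideal.subset_span ⟨F, hF, rfl⟩)
    obtain ⟨i, hiC, hiD⟩ := h D hD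
    exact ⟨i, hiC, hDF hiD⟩
  · intro h F hF
    obtain ⟨G, hG, hGF⟩ := sqfreeMonomial_mem_span.1 hF.1
    obtain ⟨i, hiC, hiG⟩ := h G hG
    exact ⟨i, hiC, hGF hiG⟩

/-! ### Packing windows, by a shortest-path potential -/

/-- Extension of a weight on `Fin n` by zero. -/
def extendZero {n : ℕ} (a : Fin n → ℕ) (i : ℕ) : ℕ := if h : i < n then a ⟨i, h⟩ else 0

theorem extendZero_val {n : ℕ} (a : Fin n → ℕ) (i : Fin n) : extendZero a i = a i := by
  simp [extendZero]

/-- `coverWeight a t (i + 1)` is the least weight of a set of vertices `≤ i` containing `i` and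
meeting all windows of length `t` that start at or before `i`. -/
noncomputable def coverWeight (a : ℕ → ℕ) (t : ℕ) : ℕ → ℕ
  | 0 => 0
  | i + 1 => a i + ⨅ j : {j : Fin (i + 1) // i < j.1 + t}, coverWeight a t j.1.1
decreasing_by exact j.1.2

/-- The least value of `coverWeight` on the last `t` indices up to `i`. -/
noncomputable def minCoverWeight (a : ℕ → ℕ) (t i : ℕ) : ℕ :=
  ⨅ j : {j : Fin (i + 1) // i < j.1 + t}, coverWeight a t j.1.1

theorem coverWeight_zero (a : ℕ → ℕ) (t : ℕ) : coverWeight a t 0 = 0 := by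
  rw [coverWeight]

theorem coverWeight_succ (a : ℕ → ℕ) (t i : ℕ) :
    coverWeight a t (i + 1) = a i + minCoverWeight a t i := by
  rw [coverWeight, minCoverWeight]

theorem minCoverWeight_le (a : ℕ → ℕ) {t i j : ℕ} (hj : j ≤ i) (hi : i < j + t) :
    minCoverWeight a t i ≤ coverWeight a t j :=
  ciInf_le (OrderBot.bddBelow _)
    (⟨⟨j, by omega⟩, hi⟩ : {j : Fin (i + 1) // i < j.1 + t})

theorem exists_minCoverWeight_eq (a : ℕ → ℕ) {t : ℕ} (ht : 1 ≤ t) (i : ℕ) :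
    ∃ j ≤ i, i < j + t ∧ minCoverWeight a t i = coverWeight a t j := by
  have : Nonempty {j : Fin (i + 1) // i < j.1 + t} := ⟨⟨⟨i, by omega⟩, by simp; omega⟩⟩
  obtain ⟨⟨j, hj⟩, h⟩ := ciInf_mem
    fun j : {j : Fin (i + 1) // i < j.1 + t} => coverWeight a t j.1.1
  exact ⟨j.1, by omega, hj, h.symm⟩

/-- Of the minimality of `coverWeight` only attainment is needed: a genuine cover realises the
value, so the hypothesis on covers bounds it below. -/
theorem exists_cover_sum_eq_coverWeight {n t : ℕ} (ht : 1 ≤ t) (a : Fin n → ℕ) (j : ℕ)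
    (hj : j ≤ n) : ∃ C : Finset (Fin n), ∑ i ∈ C, a i = coverWeight (extendZero a) t j ∧
      (∀ i ∈ C, i.1 < j) ∧ ∀ l < j, ∃ i ∈ C, i ∈ window n t l := by
  induction j using Nat.strong_induction_on with
  | _ j ih =>
    obtain _ | i := j
    · exact ⟨∅, by simp [coverWeight_zero], by simp, by simp⟩
    · obtain ⟨j, hji, hij, he⟩ := exists_minCoverWeight_eq (extendZero a) ht i
      obtain ⟨C, hC, hlt, hcov⟩ := ih j (by omega) (by omega)
      have hi : (⟨i, by omega⟩ : Fin n) ∉ C := fun h => by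
        have := hlt _ h
        simp only at this
        omega
      refine ⟨insert ⟨i, by omega⟩ C, ?_, ?_, ?_⟩
      · rw [Finset.sum_insert hi, hC, coverWeight_succ, he, ← extendZero_val a]
      · intro m hm
        rcases Finset.mem_insert.1 hm with rfl | hm
        · simp
        · have := hlt m hm
          omega
      -- Windows starting before `j` are already met; those starting in `[j, i]` contain `i`,
      -- because `i < j + t`.
      · intro l hl
        by_cases hlj : l < j
        · obtain ⟨m, hm, hml⟩ := hcov l hlj
          exact ⟨m, Finset.mem_insert_of_mem hm, hml⟩
        · refine ⟨_, Finset.mem_insert_self _ _, mem_window.2 ?_⟩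
          simp only
          omega

/-- Take the `t` vertices just before the first `i` where `minCoverWeight` exceeds `k`. For such
`m`, index `m + 1` competes in the minimum at `i`, which gives the upper inequality. Thus vertex `m`
is used only by levels `k` in an interval of length `a m`, so windows for distinct levels never
overload it. -/
theorem exists_window_between_coverWeights {a : ℕ → ℕ} {n t k : ℕ}
    (hk : k < minCoverWeight a t n) :
    ∃ l, l + t ≤ n ∧ ∀ m, l ≤ m → m < l + t →
      minCoverWeight a t m ≤ k ∧ k < minCoverWeight a t m + a m := by
  classical
  have hex : ∃ i, k < minCoverWeight a t i := ⟨n, hk⟩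
  have hfind := Nat.find_spec hex
  have hle : Nat.find hex ≤ n := Nat.find_min' hex hk
  have hmin : ∀ m < Nat.find hex, minCoverWeight a t m ≤ k :=
    fun m hm => not_lt.1 (Nat.find_min hex hm)
  generalize Nat.find hex = i at *
  have hti : t ≤ i := by
    by_contra h
    -- For `i < t` the empty set, index `0`, still competes, so the minimum is zero.
    have := minCoverWeight_le a (t := t) (i := i) (j := 0) (Nat.zero_le _) (by omega)
    rw [coverWeight_zero] at this
    omega
  refine ⟨i - t, by omega, fun m hlm hml => ⟨hmin m (by omega), ?_⟩⟩
  have := minCoverWeight_le a (t := t) (i := i) (j := m + 1) (by omega) (by omega)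
  rw [coverWeight_succ] at this
  omega

/-- Integral packing of windows: a weight giving at least `s` to every set meeting all windows
dominates a sum of `s` windows. -/
theorem exists_windows_packing {n t : ℕ} (ht : 1 ≤ t) (s : ℕ) (a : Fin n → ℕ)
    (h : ∀ C : Finset (Fin n), IsVertexCover (windows n t) C → s ≤ ∑ i ∈ C, a i) :
    ∃ F : Fin s → Finset (Fin n), (∀ k, F k ∈ windows n t) ∧
      ∀ i, (∑ k, if i ∈ F k then 1 else 0) ≤ a i := by
  have hs : s ≤ minCoverWeight (extendZero a) t n := by
    obtain ⟨j, hjn, hnj, he⟩ := exists_minCoverWeight_eq (extendZero a) ht n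
    obtain ⟨C, hC, -, hcov⟩ := exists_cover_sum_eq_coverWeight ht a j hjn
    rw [he, ← hC]
    refine h C ?_
    rintro F ⟨l, hl, rfl⟩
    exact hcov l (by omega)
  choose l hl hbetween using fun k : Fin s =>
    exists_window_between_coverWeights (k.2.trans_le hs)
  refine ⟨fun k => window n t (l k), fun k => ⟨l k, hl k, rfl⟩, fun i => ?_⟩
  rw [← Finset.card_filter, ← Finset.card_map Fin.valEmbedding]
  calc _ ≤ (Finset.Ico (minCoverWeight (extendZero a) t i)
        (minCoverWeight (extendZero a) t i + a i)).card := by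
        refine Finset.card_le_card fun x hx => ?_
        obtain ⟨k, hk, rfl⟩ := Finset.mem_map.1 hx
        have hik := mem_window.1 (Finset.mem_filter.1 hk).2
        have := hbetween k i hik.1 hik.2
        rw [extendZero_val] at this
        exact Finset.mem_Ico.2 this
    _ = a i := by simp

/-! ### Packing covers, by residue classes -/

theorem exists_mod_eq_between {s k : ℕ} (hk : k < s) (m : ℕ) :
    ∃ x, m ≤ x ∧ x < m + s ∧ x % s = k := by
  -- The quotient is `⌈(m - k) / s⌉`; the subtraction does not truncate because `k < s`.
  refine ⟨k + s * ((m + s - 1 - k) / s), ?_, ?_, ?_⟩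
  · have := Nat.lt_mul_div_succ (m + s - 1 - k) (by omega : 0 < s)
    rw [Nat.mul_add_one] at this
    omega
  · have := Nat.mul_div_le (m + s - 1 - k) s
    omega
  · rw [Nat.add_mul_mod_self_left, Nat.mod_eq_of_lt hk]

theorem exists_between_of_le_of_lt (A : ℕ → ℕ) {x l : ℕ} (hl : A l ≤ x) (t : ℕ)
    (ht : x < A (l + t)) : ∃ i, l ≤ i ∧ i < l + t ∧ A i ≤ x ∧ x < A (i + 1) := by
  induction t with
  | zero => exact absurd ht (not_lt.2 hl)
  | succ t ih =>
    by_cases h : x < A (l + t)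
    · obtain ⟨i, h1, h2, h3⟩ := ih h
      exact ⟨i, h1, by omega, h3⟩
    · exact ⟨l + t, by omega, by omega, not_lt.1 h, ht⟩

theorem sum_window_eq {n t l : ℕ} (h : l + t ≤ n) (a : Fin n → ℕ) :
    ∑ i ∈ window n t l, a i = ∑ i ∈ Finset.Ico l (l + t), extendZero a i := by
  refine Finset.sum_bij (fun i _ => i.1) (fun i hi => Finset.mem_Ico.2 (mem_window.1 hi))
    (fun i _ j _ hij => Fin.ext hij) (fun m hm => ?_) (fun i _ => (extendZero_val a i).symm)
  have hm' := Finset.mem_Ico.1 hm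
  exact ⟨⟨m, by omega⟩, mem_window.2 hm', rfl⟩

/-- Integral packing of covers: a weight giving at least `s` to every window dominates a sum of
`s` sets meeting all windows. The covers are obtained by listing the vertices in increasing order,
with multiplicities, and sorting the list into the residue classes modulo `s`. -/
theorem exists_covers_packing {n t : ℕ} (s : ℕ) (a : Fin n → ℕ)
    (h : ∀ F ∈ windows n t, s ≤ ∑ i ∈ F, a i) :
    ∃ C : Fin s → Finset (Fin n), (∀ k, IsVertexCover (windows n t) (C k)) ∧
      ∀ i, (∑ k, if i ∈ C k then 1 else 0) ≤ a i := by
  classical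
  -- Vertex `i` owns the `a i` labels in `[A i, A (i + 1))`, hence lies in at most `a i` classes; a
  -- window owns at least `s` consecutive labels, hence meets every class.
  set A : ℕ → ℕ := fun m => ∑ i ∈ Finset.range m, extendZero a i with hA
  have hmem : ∀ (k : Fin s) (i : Fin n),
      i ∈ Finset.univ.filter (fun i : Fin n => ∃ x, A i ≤ x ∧ x < A (i + 1) ∧ x % s = k.1) ↔
        ∃ x, A i ≤ x ∧ x < A (i + 1) ∧ x % s = k.1 := fun k i => by simp
  refine ⟨fun k => Finset.univ.filter
    fun i : Fin n => ∃ x, A i ≤ x ∧ x < A (i + 1) ∧ x % s = k.1, ?_, fun i => ?_⟩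
  · rintro k F ⟨l, hl, rfl⟩
    have hsum := h _ ⟨l, hl, rfl⟩
    rw [sum_window_eq hl] at hsum
    have hAl : A l + s ≤ A (l + t) := by
      rw [hA]
      simp only
      rw [← Finset.sum_range_add_sum_Ico _ (Nat.le_add_right l t)]
      omega
    obtain ⟨x, hx1, hx2, hx3⟩ := exists_mod_eq_between k.2 (A l)
    obtain ⟨i, hli, hil, hAi, hAi'⟩ := exists_between_of_le_of_lt A hx1 t (by omega)
    exact ⟨⟨i, by omega⟩, (hmem k _).2 ⟨x, hAi, hAi', hx3⟩, mem_window.2 ⟨hli, hil⟩⟩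
  · rw [← Finset.card_filter, ← Finset.card_map Fin.valEmbedding]
    calc _ ≤ ((Finset.Ico (A i) (A (i + 1))).image (· % s)).card := by
          refine Finset.card_le_card fun y hy => ?_
          obtain ⟨k, hk, rfl⟩ := Finset.mem_map.1 hy
          obtain ⟨x, hx1, hx2, hx3⟩ := (hmem k i).1 (Finset.mem_filter.1 hk).2
          exact Finset.mem_image.2 ⟨x, Finset.mem_Ico.2 ⟨hx1, hx2⟩, hx3⟩
      _ ≤ (Finset.Ico (A i) (A (i + 1))).card := Finset.card_image_le
      _ = a i := by
          rw [Nat.card_Ico, hA]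
          simp only
          rw [Finset.sum_range_succ, extendZero_val]
          omega

end PathIdeals

theorem theorem2p3 (K : Type*) [Field K] (n t : ℕ) (ht : 1 ≤ t) (htn : t ≤ n) :
    PathIdeals.NormallyTorsionFree
        (PathIdeals.pathIdeal K (SimpleGraph.pathGraph n) t) ∧
      PathIdeals.NormallyTorsionFree
        (PathIdeals.alexanderDual (PathIdeals.pathIdeal K (SimpleGraph.pathGraph n) t)) := by
  simp only [PathIdeals.pathIdeal, PathIdeals.alexanderDual,
    PathIdeals.isVertexCover_facets_span, PathIdeals.tPaths_pathGraph ht]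
  constructor
  · exact PathIdeals.normallyTorsionFree_span
      (𝒞 := {C | PathIdeals.IsVertexCover (PathIdeals.windows n t) C})
      (fun C hC F hF => hC F hF) (PathIdeals.exists_windows_packing ht)
  · refine PathIdeals.normallyTorsionFree_span (𝒞 := PathIdeals.windows n t)
      (fun F hF C hC => ?_) PathIdeals.exists_covers_packing
    obtain ⟨i, hiC, hiF⟩ := hC F hF
    exact ⟨i, hiF, hiC⟩
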